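/- Let $G$ be a finite abelian group, written additively, and $\hat G$ its dual group, the group of homomorphisms $G\to S^1$. Let $\mathcal F:\mathbb C^G\to\mathbb C^{\hat G}$ be the Fourier transform $$\mathcal F(f)(\chi)=\frac1{\sqrt{|G|}}\sum_{g\in G}f(g)\chi(g),$$ and, for an isomorphism $j:G\to\hat G$, let $\tilde j:\mathbb C^{\hat G}\to\mathbb C^G$ be given by $\tilde j(\phi)(g)=\phi(j(g))$. Thus $\tilde j\circ\mathcal F$ is a linear operator on $\mathbb C^G$. **Theorem.** Let $p>2$ be a prime, $G=(\mathbb Z/p\mathbb Z)^2$, and let $j:G\to\hat G$ be the isomorphism with $$j(g)(h)=e^{2\pi i\langle h,M_jg\rangle/p},\qquad M_j=\begin{pmatrix}1&0\\1&1\end{pmatrix},$$ where $\langle h,g\rangle=h_1g_1+h_2g_2$. Then every eigenvalue of $\tilde j\circ\mathcal F$ is a $6$th root of unity, and if $p\ge5$, then every $6$th root of unity is an eigenvalue of $\tilde j\circ\mathcal F$. If moreover $p\equiv1\pmod 3$ and $p\ge7$, then the multiplicities (dimensions of the eigenspaces) of the eigenvalues are the following: $$\begin{array}{rl} \lambda &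 \text{multiplicity}\\ \hline 1 & \frac12\frac{(p-4)(p-7)}9+\frac{(p-1)^2}9+p-1\\[2pt] -1 & \frac12\frac{(p-4)(p-7)}9+\frac{(p-1)^2}9+2\,\frac{p-4}3+1\\[2pt] e^{2\pi i/6} & \frac32\frac{(p-4)(p-1)}9+2\,\frac{p-1}3\\[2pt] e^{-2\pi i/6} & \frac32\frac{(p-4)(p-1)}9+2\,\frac{p-1}3\\[2pt] -e^{2\pi i/6} & \frac32\frac{(p-4)(p-1)}9+p-1\\[2pt] -e^{-2\pi i/6} & \frac32\frac{(p-4)(p-1)}9+p-1 \end{array}$$ -/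

import Mathlib

open scoped Matrix

/-- The dual group of a finite abelian group `G` (written additively): the homomorphisms
from `G` to the unit circle. Its addition is the pointwise multiplication of characters. -/
abbrev DualGroup (G : Type*) [AddCommGroup G] : Type _ := AddChar G Circle

/-- The Fourier transform `ℂ^G → ℂ^Ĝ`,
`(𝓕 f)(χ) = |G|^(-1/2) * ∑ g, f g * χ g`. -/
noncomputable def abstractFourier (G : Type*) [AddCommGroup G] [Fintype G] :
    (G → ℂ) →ₗ[ℂ] (DualGroup G → ℂ) where
  toFun f χ := (1 / (Real.sqrt (Fintype.card G) : ℂ)) * ∑ g, f g * (χ g : ℂ)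
  map_add' f₁ f₂ := by
    ext χ
    simp [add_mul, Finset.sum_add_distrib, mul_add]
  map_smul' c f := by
    ext χ
    simp only [Pi.smul_apply, smul_eq_mul, RingHom.id_apply, Finset.mul_sum]
    exact Finset.sum_congr rfl fun g _ => by ring

/-- The pullback `j̃ : ℂ^Ĝ → ℂ^G` of a map `j : G → Ĝ`, `(j̃ φ)(g) = φ (j g)`. -/
def dualPullback {G : Type*} [AddCommGroup G] (j : G → DualGroup G) :
    (DualGroup G → ℂ) →ₗ[ℂ] (G → ℂ) where
  toFun φ g := φ (j g)
  map_add' _ _ := rfl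
  map_smul' _ _ := rfl

/-- The concrete Fourier transform `j̃ ∘ 𝓕 : ℂ^G → ℂ^G`. -/
noncomputable def concreteFourier {G : Type*} [AddCommGroup G] [Fintype G]
    (j : G → DualGroup G) : Module.End ℂ (G → ℂ) :=
  dualPullback j ∘ₗ abstractFourier G

/-- `M` is the matrix `M_j` of the isomorphism `j` from `(ℤ/nℤ)^m` to its dual:
`j(g)(h) = e_n(⟨h, M g⟩)`, where `e_n(x) = exp (2πix/n)`. -/
def HasDualMatrix {n m : ℕ} [NeZero n]
    (j : (Fin m → ZMod n) ≃+ DualGroup (Fin m → ZMod n))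
    (M : Matrix (Fin m) (Fin m) (ZMod n)) : Prop :=
  ∀ g h : Fin m → ZMod n, j g h = ZMod.toCircle (h ⬝ᵥ (M *ᵥ g))

/-- The multiplicity of `μ` as an eigenvalue of `A`: the dimension of the space of
all `v` with `A v = μ v`. -/
noncomputable def eigenMultiplicity {V : Type*} [AddCommGroup V] [Module ℂ V]
    (A : Module.End ℂ V) (μ : ℂ) : ℕ :=
  Module.finrank ℂ (Module.End.eigenspace A μ)

/-! Write `T` for the operator `j̃ ∘ 𝓕`. By orthogonality of characters, `T ^ 2` is composition with
a linear map `R` of the plane satisfying `R³ = 1`. Hence `T ^ 6 = 1`, which confines the eigenvalues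
to sixth roots of unity.

For such a root `μ`, averaging `(μ⁻¹ • T) ^ k` over `k < 6` projects onto the eigenspace. For `p ≥
5` this projection does not kill a delta function at a nonzero point, so `μ` occurs. Its trace is
the multiplicity, so only the traces of the powers of `T` are needed. Even powers count fixed points
of powers of `R`; `T ^ 3` has an alternating kernel; `T` and `T ^ 5` give quadratic Gauss sums of
`x² + xy + y²`, which splits over `ZMod p` when `p ≡ 1 mod 3`. -/

/-- For an operator of finite order, averaging its rescaled powers projects onto an eigenspace. -/
theorem isProj_eigenspace_average {V : Type*} [AddCommGroup V] [Module ℂ V]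
    (T : Module.End ℂ V) {n : ℕ} (hn : n ≠ 0) (hT : T ^ n = 1) {μ : ℂ} (hμ : μ ^ n = 1) :
    LinearMap.IsProj (Module.End.eigenspace T μ)
      ((n : ℂ)⁻¹ • ∑ k ∈ Finset.range n, (μ⁻¹ • T) ^ k) := by
  have hμ0 : μ ≠ 0 := by
    rintro rfl
    simp [hn] at hμ
  have hn' : (n : ℂ) ≠ 0 := Nat.cast_ne_zero.mpr hn
  constructor
  · intro x
    have h := mul_geom_sum (μ⁻¹ • T) n
    rw [smul_pow, hT, inv_pow, hμ, inv_one, one_smul, sub_self, sub_mul, one_mul,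
      sub_eq_zero, smul_mul_assoc, inv_smul_eq_iff₀ hμ0] at h
    have h' := LinearMap.congr_fun h x
    rw [Module.End.mem_eigenspace_iff, LinearMap.smul_apply, map_smul, smul_comm μ]
    exact congrArg _ h'
  · intro x hx
    rw [Module.End.mem_eigenspace_iff] at hx
    have hk : ∀ k : ℕ, ((μ⁻¹ • T) ^ k) x = x := by
      intro k
      induction k with
      | zero => simp
      | succ k ih => rw [pow_succ, Module.End.mul_apply, LinearMap.smul_apply, hx,
          inv_smul_smul₀ hμ0, ih]
    simp [LinearMap.sum_apply, hk, ← Nat.cast_smul_eq_nsmul ℂ, smul_smul, hn']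

theorem eigenMultiplicity_eq_average_trace {V : Type*} [AddCommGroup V] [Module ℂ V]
    [FiniteDimensional ℂ V] (T : Module.End ℂ V) {n : ℕ} (hn : n ≠ 0) (hT : T ^ n = 1)
    {μ : ℂ} (hμ : μ ^ n = 1) :
    (eigenMultiplicity T μ : ℂ) =
      (n : ℂ)⁻¹ * ∑ k ∈ Finset.range n, (μ⁻¹) ^ k * LinearMap.trace ℂ V (T ^ k) := by
  rw [eigenMultiplicity, ← (isProj_eigenspace_average T hn hT hμ).trace]
  simp [smul_pow]

theorem trace_eq_sum_single {ι : Type*} [Fintype ι] [DecidableEq ι]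
    (T : Module.End ℂ (ι → ℂ)) :
    LinearMap.trace ℂ (ι → ℂ) T = ∑ i, T (Pi.single i 1) i := by
  rw [LinearMap.trace_eq_matrix_trace ℂ (Pi.basisFun ℂ ι), Matrix.trace]
  simp

theorem sum_fin_two_fun {R M : Type*} [Fintype R] [AddCommMonoid M]
    (F : (Fin 2 → R) → M) : ∑ g, F g = ∑ x, ∑ y, F ![x, y] := by
  rw [← (finTwoArrowEquiv R).symm.sum_comp, Fintype.sum_prod_type]
  rfl

/-! ### Character sums and the rotation of the plane -/

section Plane

variable {p : ℕ} [Fact p.Prime]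

theorem sum_stdAddChar_mul (b : ZMod p) :
    ∑ x : ZMod p, ZMod.stdAddChar (x * b) = if b = 0 then (p : ℂ) else 0 := by
  have h := AddChar.sum_mulShift b (ZMod.isPrimitive_stdAddChar p)
  rw [h]
  split_ifs <;> simp [ZMod.card]

theorem sum_stdAddChar_plane (a b : ZMod p) :
    ∑ h : Fin 2 → ZMod p, ZMod.stdAddChar (h 0 * a + h 1 * b) =
      if a = 0 ∧ b = 0 then (p : ℂ) ^ 2 else 0 := by
  rw [sum_fin_two_fun]
  simp only [Matrix.cons_val_zero, Matrix.cons_val_one, AddChar.map_add_eq_mul,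
    ← Finset.mul_sum, ← Finset.sum_mul, sum_stdAddChar_mul]
  split_ifs <;> simp_all [sq]

/-- The order three automorphism of the plane by which `(j̃ ∘ 𝓕)²` acts. -/
def planeRotation (g : Fin 2 → ZMod p) : Fin 2 → ZMod p := ![g 1, -g 0 - g 1]

theorem planeRotation_cube (g : Fin 2 → ZMod p) :
    planeRotation (planeRotation (planeRotation g)) = g := by
  ext i
  fin_cases i <;> simp [planeRotation] <;> ring

/-- The rotation minus the identity has determinant `3`. -/
theorem planeRotation_eq_self_iff (hp : (3 : ZMod p) ≠ 0) (g : Fin 2 → ZMod p) :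
    planeRotation g = g ↔ g = 0 := by
  constructor
  · intro h
    have h0 : g 1 = g 0 := congrFun h 0
    have h1 : -g 0 - g 1 = g 1 := congrFun h 1
    have h3 : 3 * g 0 = 0 := by linear_combination -h1 - 2 * h0
    have hz := (mul_eq_zero.mp h3).resolve_left hp
    ext i
    fin_cases i
    · exact hz
    · exact h0.trans hz
  · rintro rfl
    ext i
    fin_cases i <;> simp [planeRotation]

theorem planeRotation_sq_eq_self_iff (hp : (3 : ZMod p) ≠ 0) (g : Fin 2 → ZMod p) :
    planeRotation (planeRotation g) = g ↔ g = 0 := by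
  rw [← planeRotation_eq_self_iff hp]
  constructor
  · intro h
    simpa only [planeRotation_cube] using (congrArg planeRotation h).symm
  · intro h
    rw [h, h]

/-! ### Powers of the operator -/

variable {j : (Fin 2 → ZMod p) ≃+ DualGroup (Fin 2 → ZMod p)}

theorem concreteFourier_plane_apply (hj : HasDualMatrix j !![1, 0; 1, 1])
    (f : (Fin 2 → ZMod p) → ℂ) (g : Fin 2 → ZMod p) :
    concreteFourier j f g =
      (p : ℂ)⁻¹ * ∑ h, f h * ZMod.stdAddChar (h 0 * g 0 + h 1 * (g 0 + g 1)) := by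
  have hs : Real.sqrt ((Fintype.card (Fin 2 → ZMod p) : ℕ) : ℝ) = p := by
    rw [Fintype.card_fun, ZMod.card, Fintype.card_fin, Nat.cast_pow,
      Real.sqrt_sq (Nat.cast_nonneg p)]
  change (1 / (Real.sqrt (Fintype.card (Fin 2 → ZMod p)) : ℂ)) *
    ∑ h, f h * ((j g h : Circle) : ℂ) = _
  rw [hs]
  simp [hj g, ZMod.stdAddChar_apply, dotProduct, Matrix.mulVec, Fin.sum_univ_two]

theorem concreteFourier_plane_sq_apply (hj : HasDualMatrix j !![1, 0; 1, 1])
    (f : (Fin 2 → ZMod p) → ℂ) (g : Fin 2 → ZMod p) :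
    (concreteFourier j ^ 2) f g = f (planeRotation g) := by
  have hp0 : (p : ℂ) ≠ 0 := Nat.cast_ne_zero.mpr (Fact.out : p.Prime).ne_zero
  have key : ∀ k : Fin 2 → ZMod p,
      ∑ h : Fin 2 → ZMod p, ZMod.stdAddChar (k 0 * h 0 + k 1 * (h 0 + h 1)) *
        ZMod.stdAddChar (h 0 * g 0 + h 1 * (g 0 + g 1)) =
      if k = planeRotation g then (p : ℂ) ^ 2 else 0 := by
    intro k
    have hiff : (k 0 + k 1 + g 0 = 0 ∧ k 1 + g 0 + g 1 = 0) ↔ k = planeRotation g := by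
      constructor
      · rintro ⟨h0, h1⟩
        ext i
        fin_cases i
        · change k 0 = g 1
          linear_combination h0 - h1
        · change k 1 = -g 0 - g 1
          linear_combination h1
      · rintro rfl
        simp [planeRotation]
        ring
    simp only [← hiff]
    rw [← sum_stdAddChar_plane]
    refine Finset.sum_congr rfl fun h _ => ?_
    rw [← AddChar.map_add_eq_mul]
    congr 1
    ring
  rw [sq, Module.End.mul_apply, concreteFourier_plane_apply hj]
  simp only [concreteFourier_plane_apply hj, Finset.mul_sum, Finset.sum_mul]
  rw [Finset.sum_comm]
  have h1 : ∀ k : Fin 2 → ZMod p,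
      ∑ h : Fin 2 → ZMod p, (p : ℂ)⁻¹ *
        ((p : ℂ)⁻¹ * (f k * ZMod.stdAddChar (k 0 * h 0 + k 1 * (h 0 + h 1))) *
          ZMod.stdAddChar (h 0 * g 0 + h 1 * (g 0 + g 1))) =
      if k = planeRotation g then f k else 0 := by
    intro k
    have := congrArg (fun z => (p : ℂ)⁻¹ * (p : ℂ)⁻¹ * f k * z) (key k)
    simp only [Finset.mul_sum] at this
    rw [Finset.sum_congr rfl fun h _ => ?_, this]
    · split_ifs
      · field_simp
      · simp
    · ring
  simp only [h1, Finset.sum_ite_eq', Finset.mem_univ, if_true]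

/-- The phase is now the standard symplectic form, which vanishes on the diagonal; this is what
makes the trace of the cube large. -/
theorem concreteFourier_plane_pow_three_apply (hj : HasDualMatrix j !![1, 0; 1, 1])
    (f : (Fin 2 → ZMod p) → ℂ) (g : Fin 2 → ZMod p) :
    (concreteFourier j ^ 3) f g =
      (p : ℂ)⁻¹ * ∑ h, f h * ZMod.stdAddChar (h 0 * g 1 - h 1 * g 0) := by
  rw [pow_succ, Module.End.mul_apply, concreteFourier_plane_sq_apply hj,
    concreteFourier_plane_apply hj]
  congr 1
  refine Finset.sum_congr rfl fun h _ => ?_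
  congr 2
  simp only [planeRotation, Matrix.cons_val_zero, Matrix.cons_val_one]
  ring

theorem concreteFourier_plane_pow_four_apply (hj : HasDualMatrix j !![1, 0; 1, 1])
    (f : (Fin 2 → ZMod p) → ℂ) (g : Fin 2 → ZMod p) :
    (concreteFourier j ^ 4) f g = f (planeRotation (planeRotation g)) := by
  rw [show 4 = 2 + 2 from rfl, pow_add, Module.End.mul_apply,
    concreteFourier_plane_sq_apply hj, concreteFourier_plane_sq_apply hj]

theorem concreteFourier_plane_pow_five_apply (hj : HasDualMatrix j !![1, 0; 1, 1])
    (f : (Fin 2 → ZMod p) → ℂ) (g : Fin 2 → ZMod p) :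
    (concreteFourier j ^ 5) f g =
      (p : ℂ)⁻¹ * ∑ h, f h * ZMod.stdAddChar (-(h 0 * (g 0 + g 1) + h 1 * g 1)) := by
  rw [pow_succ, Module.End.mul_apply, concreteFourier_plane_pow_four_apply hj,
    concreteFourier_plane_apply hj]
  congr 1
  refine Finset.sum_congr rfl fun h _ => ?_
  congr 2
  simp only [planeRotation, Matrix.cons_val_zero, Matrix.cons_val_one]
  ring

theorem concreteFourier_plane_pow_six (hj : HasDualMatrix j !![1, 0; 1, 1]) :
    concreteFourier j ^ 6 = 1 := by
  refine LinearMap.ext fun f => funext fun g => ?_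
  rw [show 6 = 4 + 2 from rfl, pow_add, Module.End.mul_apply,
    concreteFourier_plane_pow_four_apply hj, concreteFourier_plane_sq_apply hj,
    planeRotation_cube, Module.End.one_apply]

/-! ### Which eigenvalues occur -/

theorem pow_six_eq_one_of_hasEigenvalue (hj : HasDualMatrix j !![1, 0; 1, 1]) {μ : ℂ}
    (hμ : (concreteFourier j).HasEigenvalue μ) : μ ^ 6 = 1 := by
  obtain ⟨v, hv⟩ := hμ.exists_hasEigenvector
  have h := hv.pow_apply 6
  rw [concreteFourier_plane_pow_six hj, Module.End.one_apply] at h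
  have h' : (μ ^ 6 - 1) • v = 0 := by rw [sub_smul, one_smul, ← h, sub_self]
  exact sub_eq_zero.mp ((smul_eq_zero.mp h').resolve_right hv.2)

theorem three_ne_zero_of_five_le (hp : 5 ≤ p) : (3 : ZMod p) ≠ 0 := by
  intro h
  have h3 : ((3 : ℕ) : ZMod p) = 0 := by exact_mod_cast h
  rw [ZMod.natCast_eq_zero_iff] at h3
  have := Nat.le_of_dvd (by norm_num) h3
  omega

theorem hasEigenvalue_of_pow_six_eq_one (hp : 5 ≤ p) (hj : HasDualMatrix j !![1, 0; 1, 1])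
    {μ : ℂ} (hμ : μ ^ 6 = 1) : (concreteFourier j).HasEigenvalue μ := by
  classical
  have h3 := three_ne_zero_of_five_le hp
  have hproj := isProj_eigenspace_average (concreteFourier j) (by norm_num)
    (concreteFourier_plane_pow_six hj) hμ
  -- Any nonzero point would do: the rotation and its square move it, so the second and fourth
  -- powers contribute nothing at `v`.
  set v : Fin 2 → ZMod p := ![1, 0] with hv
  have hv0 : v ≠ 0 := fun h => one_ne_zero (congrFun h 0 : (1 : ZMod p) = 0)
  have hr1 : planeRotation v ≠ v := fun h => hv0 ((planeRotation_eq_self_iff h3 v).mp h)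
  have hr2 : planeRotation (planeRotation v) ≠ v :=
    fun h => hv0 ((planeRotation_sq_eq_self_iff h3 v).mp h)
  refine Module.End.hasEigenvalue_of_hasEigenvector
    (x := _) ⟨hproj.map_mem (Pi.single v 1), fun hzero => ?_⟩
  have hval := congrFun hzero v
  simp only [smul_pow, Finset.sum_range_succ, Finset.sum_range_zero, zero_add, pow_zero,
    one_smul, pow_one, LinearMap.smul_apply, LinearMap.add_apply, Pi.smul_apply, Pi.add_apply,
    Pi.zero_apply, Module.End.one_apply, concreteFourier_plane_apply hj,
    concreteFourier_plane_sq_apply hj, concreteFourier_plane_pow_three_apply hj,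
    concreteFourier_plane_pow_four_apply hj, concreteFourier_plane_pow_five_apply hj,
    Pi.single_eq_same, Pi.single_eq_of_ne hr1, Pi.single_eq_of_ne hr2, smul_eq_mul, mul_zero,
    add_zero, Pi.single_apply, ite_mul, one_mul, zero_mul, Finset.sum_ite_eq',
    Finset.mem_univ, if_true] at hval
  have hz : ‖μ⁻¹‖ = 1 := by
    rw [norm_inv, Complex.norm_eq_one_of_pow_eq_one hμ (by norm_num), inv_one]
  -- Each of the three odd powers contributes a term of norm `1 / p`. Since `3 / p < 1`, they cannot
  -- cancel the `1` from the identity.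
  have hterm : ∀ (k : ℕ) (a : ZMod p),
      ‖(μ⁻¹) ^ k * ((p : ℂ)⁻¹ * ZMod.stdAddChar a)‖ = (p : ℝ)⁻¹ := by
    intro k a
    rw [norm_mul, norm_mul, norm_pow, hz, AddChar.norm_apply]
    simp
  have hone : ∀ a b c : ℂ, ((6 : ℕ) : ℂ)⁻¹ * (1 + a + b + c) = 0 →
      1 ≤ ‖a‖ + ‖b‖ + ‖c‖ := by
    intro a b c h
    have h' : a + b + c = -1 := by
      have := (mul_eq_zero.mp h).resolve_left (by norm_num)
      linear_combination this
    calc (1 : ℝ) = ‖a + b + c‖ := by rw [h', norm_neg, norm_one]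
      _ ≤ _ := norm_add₃_le
  have hle := hone _ _ _ hval
  rw [← pow_one μ⁻¹] at hle
  simp only [← pow_mul, one_mul, hterm] at hle
  have hp' : (5 : ℝ) ≤ p := by exact_mod_cast hp
  have : (p : ℝ)⁻¹ ≤ 5⁻¹ := inv_anti₀ (by norm_num) hp'
  linarith

/-! ### Traces and multiplicities -/

theorem exists_primitive_cube_root (hp : p ≡ 1 [MOD 3]) :
    ∃ w : ZMod p, w ^ 2 + w + 1 = 0 := by
  have hdvd : 3 ∣ Nat.card (ZMod p)ˣ := by
    rw [Nat.card_eq_fintype_card, ZMod.card_units p]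
    exact (Nat.modEq_iff_dvd' (Fact.out : p.Prime).one_le).mp hp.symm
  have : Fact (Nat.Prime 3) := ⟨Nat.prime_three⟩
  obtain ⟨u, hu⟩ := exists_prime_orderOf_dvd_card' 3 hdvd
  have hu3 : (u : ZMod p) ^ 3 = 1 := by
    rw [← Units.val_pow_eq_pow_val, ← hu, pow_orderOf_eq_one, Units.val_one]
  have hu1 : (u : ZMod p) - 1 ≠ 0 := by
    intro h
    have : u = 1 := Units.ext (sub_eq_zero.mp h)
    simp [this] at hu
  refine ⟨u, (mul_eq_zero.mp ?_).resolve_left hu1⟩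
  linear_combination hu3

/-- With `w` a primitive cube root of unity, `x = u + w * y` turns `x² + xy + y²` into `u² + (2w +
1)uy`. This is linear in `y`, so summing over `y` leaves only `u = 0`. -/
theorem sum_stdAddChar_quadratic (hp : p ≡ 1 [MOD 3]) (h3 : (3 : ZMod p) ≠ 0)
    {c : ZMod p} (hc : c ≠ 0) :
    ∑ g : Fin 2 → ZMod p,
      ZMod.stdAddChar (c * (g 0 * g 0 + g 1 * (g 0 + g 1))) = (p : ℂ) := by
  obtain ⟨w, hw⟩ := exists_primitive_cube_root hp
  -- Its square is `-3`.
  have hd : 2 * w + 1 ≠ 0 := by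
    intro h
    apply h3
    linear_combination 4 * hw - (2 * w + 1) * h
  rw [sum_fin_two_fun, Finset.sum_comm]
  have h1 : ∀ y : ZMod p,
      ∑ x : ZMod p, ZMod.stdAddChar (c * (x * x + y * (x + y))) =
      ∑ u : ZMod p, ZMod.stdAddChar (c * u ^ 2) * ZMod.stdAddChar (y * (c * (2 * w + 1) * u)) := by
    intro y
    rw [← Equiv.sum_comp (Equiv.addRight (w * y))]
    refine Finset.sum_congr rfl fun u _ => ?_
    rw [← AddChar.map_add_eq_mul]
    congr 1
    simp only [Equiv.coe_addRight]
    linear_combination c * y ^ 2 * hw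
  simp only [Matrix.cons_val_zero, Matrix.cons_val_one, h1]
  rw [Finset.sum_comm]
  simp only [← Finset.mul_sum, sum_stdAddChar_mul]
  simp [hc, hd]

theorem trace_concreteFourier_plane (hp : p ≡ 1 [MOD 3]) (h3 : (3 : ZMod p) ≠ 0)
    (hj : HasDualMatrix j !![1, 0; 1, 1]) :
    LinearMap.trace ℂ _ (concreteFourier j) = 1 := by
  classical
  have hp0 : (p : ℂ) ≠ 0 := Nat.cast_ne_zero.mpr (Fact.out : p.Prime).ne_zero
  rw [trace_eq_sum_single]
  simp only [concreteFourier_plane_apply hj, Pi.single_apply, ite_mul, one_mul, zero_mul,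
    Finset.sum_ite_eq', Finset.mem_univ, if_true, ← Finset.mul_sum]
  have h := sum_stdAddChar_quadratic hp h3 (one_ne_zero (α := ZMod p))
  simp only [one_mul] at h
  rw [h, inv_mul_cancel₀ hp0]

theorem trace_concreteFourier_plane_sq (h3 : (3 : ZMod p) ≠ 0)
    (hj : HasDualMatrix j !![1, 0; 1, 1]) :
    LinearMap.trace ℂ _ (concreteFourier j ^ 2) = 1 := by
  classical
  rw [trace_eq_sum_single]
  simp [concreteFourier_plane_sq_apply hj, Pi.single_apply, planeRotation_eq_self_iff h3]

theorem trace_concreteFourier_plane_pow_three (hj : HasDualMatrix j !![1, 0; 1, 1]) :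
    LinearMap.trace ℂ _ (concreteFourier j ^ 3) = p := by
  classical
  have hp0 : (p : ℂ) ≠ 0 := Nat.cast_ne_zero.mpr (Fact.out : p.Prime).ne_zero
  rw [trace_eq_sum_single]
  simp only [concreteFourier_plane_pow_three_apply hj, Pi.single_apply, ite_mul, one_mul,
    zero_mul, Finset.sum_ite_eq', Finset.mem_univ, if_true, ← Finset.mul_sum]
  simp only [mul_comm, sub_self, AddChar.map_zero_eq_one]
  simp [ZMod.card, sq, hp0]

theorem trace_concreteFourier_plane_pow_four (h3 : (3 : ZMod p) ≠ 0)
    (hj : HasDualMatrix j !![1, 0; 1, 1]) :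
    LinearMap.trace ℂ _ (concreteFourier j ^ 4) = 1 := by
  classical
  rw [trace_eq_sum_single]
  simp [concreteFourier_plane_pow_four_apply hj, Pi.single_apply,
    planeRotation_sq_eq_self_iff h3]

theorem trace_concreteFourier_plane_pow_five (hp : p ≡ 1 [MOD 3]) (h3 : (3 : ZMod p) ≠ 0)
    (hj : HasDualMatrix j !![1, 0; 1, 1]) :
    LinearMap.trace ℂ _ (concreteFourier j ^ 5) = 1 := by
  classical
  have hp0 : (p : ℂ) ≠ 0 := Nat.cast_ne_zero.mpr (Fact.out : p.Prime).ne_zero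
  rw [trace_eq_sum_single]
  simp only [concreteFourier_plane_pow_five_apply hj, Pi.single_apply, ite_mul, one_mul,
    zero_mul, Finset.sum_ite_eq', Finset.mem_univ, if_true, ← Finset.mul_sum]
  rw [inv_mul_eq_one₀ hp0, ← sum_stdAddChar_quadratic hp h3 (neg_ne_zero.mpr one_ne_zero)]
  refine Finset.sum_congr rfl fun g _ => ?_
  congr 1
  ring

/-- The traces of the powers `0` to `5` are `p², 1, 1, p, 1, 1`. -/
theorem eigenMultiplicity_concreteFourier_plane (hp : p ≡ 1 [MOD 3]) (h3 : (3 : ZMod p) ≠ 0)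
    (hj : HasDualMatrix j !![1, 0; 1, 1]) {μ : ℂ} (hμ : μ ^ 6 = 1) :
    (eigenMultiplicity (concreteFourier j) μ : ℂ) =
      (p ^ 2 + p * μ ^ 3 + μ + μ ^ 2 + μ ^ 4 + μ ^ 5) / 6 := by
  have hinv : μ⁻¹ = μ ^ 5 := inv_eq_of_mul_eq_one_right (by rw [← hμ]; ring)
  rw [eigenMultiplicity_eq_average_trace _ (by norm_num) (concreteFourier_plane_pow_six hj) hμ]
  simp only [Finset.sum_range_succ, Finset.sum_range_zero, zero_add, pow_zero, pow_one,
    LinearMap.trace_one, trace_concreteFourier_plane hp h3 hj,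
    trace_concreteFourier_plane_sq h3 hj, trace_concreteFourier_plane_pow_three hj,
    trace_concreteFourier_plane_pow_four h3 hj, trace_concreteFourier_plane_pow_five hp h3 hj,
    Module.finrank_fintype_fun_eq_card, Fintype.card_fun, ZMod.card, Fintype.card_fin, hinv]
  push_cast
  have h10 : (μ ^ 5) ^ 2 = μ ^ 4 := by linear_combination μ ^ 4 * hμ
  have h15 : (μ ^ 5) ^ 3 = μ ^ 3 := by linear_combination (μ ^ 9 + μ ^ 3) * hμ
  have h20 : (μ ^ 5) ^ 4 = μ ^ 2 := by linear_combination (μ ^ 14 + μ ^ 8 + μ ^ 2) * hμ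
  have h25 : (μ ^ 5) ^ 5 = μ := by
    linear_combination (μ ^ 19 + μ ^ 13 + μ ^ 7 + μ) * hμ
  rw [h10, h15, h20, h25]
  ring

/-- The hypothesis on `μ` says that it is a root of the sixth cyclotomic polynomial, which treats
both primitive sixth roots at once. -/
theorem eigenMultiplicity_of_sq_eq_sub_one (hp : p ≡ 1 [MOD 3]) (h3 : (3 : ZMod p) ≠ 0)
    (hj : HasDualMatrix j !![1, 0; 1, 1]) {μ : ℂ} (hμ : μ ^ 2 = μ - 1) :
    (eigenMultiplicity (concreteFourier j) μ : ℚ) = ((p : ℚ) ^ 2 - p) / 6 := by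
  have h3' : μ ^ 3 = -1 := by linear_combination (μ + 1) * hμ
  have h := eigenMultiplicity_concreteFourier_plane hp h3 hj
    (μ := μ) (by linear_combination (μ ^ 3 - 1) * h3')
  have h' : (eigenMultiplicity (concreteFourier j) μ : ℂ) = ((p : ℂ) ^ 2 - p) / 6 := by
    rw [h]
    linear_combination (p + μ + μ ^ 2) / 6 * h3'
  exact_mod_cast h'

/-- The analogue for the primitive cube roots of unity, the negatives of the primitive sixth roots.
-/
theorem eigenMultiplicity_of_sq_eq_neg_sub_one (hp : p ≡ 1 [MOD 3]) (h3 : (3 : ZMod p) ≠ 0)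
    (hj : HasDualMatrix j !![1, 0; 1, 1]) {μ : ℂ} (hμ : μ ^ 2 = -μ - 1) :
    (eigenMultiplicity (concreteFourier j) μ : ℚ) = ((p : ℚ) ^ 2 + p - 2) / 6 := by
  have h3' : μ ^ 3 = 1 := by linear_combination (μ - 1) * hμ
  have h := eigenMultiplicity_concreteFourier_plane hp h3 hj
    (μ := μ) (by linear_combination (μ ^ 3 + 1) * h3')
  have h' : (eigenMultiplicity (concreteFourier j) μ : ℂ) = ((p : ℂ) ^ 2 + p - 2) / 6 := by
    rw [h]
    linear_combination (p + μ + μ ^ 2) / 6 * h3' + 2 / 6 * hμ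
  exact_mod_cast h'

end Plane

theorem exp_two_pi_I_div_six_sq :
    Complex.exp (2 * Real.pi * Complex.I / 6) ^ 2 =
      Complex.exp (2 * Real.pi * Complex.I / 6) - 1 := by
  set z := Complex.exp (2 * Real.pi * Complex.I / 6) with hz
  have hprim : IsPrimitiveRoot z 6 := Complex.isPrimitiveRoot_exp 6 (by norm_num)
  have h3 : z ^ 3 = -1 := by
    rw [hz, ← Complex.exp_nat_mul, ← Complex.exp_pi_mul_I]
    congr 1
    push_cast
    ring
  have h1 : z + 1 ≠ 0 := by
    intro h
    refine hprim.pow_ne_one_of_pos_of_lt (l := 2) (by norm_num) (by norm_num) ?_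
    linear_combination (z - 1) * h
  have h0 : (z + 1) * (z ^ 2 - (z - 1)) = 0 := by linear_combination h3
  exact sub_eq_zero.mp ((mul_eq_zero.mp h0).resolve_left h1)


theorem mainTheorem4 (p : ℕ) [Fact p.Prime] (hp : 2 < p)
    (j : (Fin 2 → ZMod p) ≃+ DualGroup (Fin 2 → ZMod p))
    (hj : HasDualMatrix j !![1, 0; 1, 1]) :
    (∀ μ : ℂ, (concreteFourier j).HasEigenvalue μ → μ ^ 6 = 1) ∧
    (5 ≤ p → ∀ μ : ℂ, (concreteFourier j).HasEigenvalue μ ↔ μ ^ 6 = 1) ∧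
    (p ≡ 1 [MOD 3] → 7 ≤ p →
      (eigenMultiplicity (concreteFourier j) 1 : ℚ) =
        1 / 2 * (((p : ℚ) - 4) * (p - 7) / 9) + ((p : ℚ) - 1) ^ 2 / 9 + p - 1 ∧
      (eigenMultiplicity (concreteFourier j) (-1) : ℚ) =
        1 / 2 * (((p : ℚ) - 4) * (p - 7) / 9) + ((p : ℚ) - 1) ^ 2 / 9
          + 2 * (((p : ℚ) - 4) / 3) + 1 ∧
      (eigenMultiplicity (concreteFourier j)
          (Complex.exp (2 * Real.pi * Complex.I / 6)) : ℚ) =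
        3 / 2 * (((p : ℚ) - 4) * (p - 1) / 9) + 2 * (((p : ℚ) - 1) / 3) ∧
      (eigenMultiplicity (concreteFourier j)
          (Complex.exp (-(2 * Real.pi * Complex.I / 6))) : ℚ) =
        3 / 2 * (((p : ℚ) - 4) * (p - 1) / 9) + 2 * (((p : ℚ) - 1) / 3) ∧
      (eigenMultiplicity (concreteFourier j)
          (-Complex.exp (2 * Real.pi * Complex.I / 6)) : ℚ) =
        3 / 2 * (((p : ℚ) - 4) * (p - 1) / 9) + p - 1 ∧
      (eigenMultiplicity (concreteFourier j)
          (-Complex.exp (-(2 * Real.pi * Complex.I / 6))) : ℚ) =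
        3 / 2 * (((p : ℚ) - 4) * (p - 1) / 9) + p - 1) := by
  refine ⟨fun μ hμ => pow_six_eq_one_of_hasEigenvalue hj hμ,
    fun h5 μ => ⟨pow_six_eq_one_of_hasEigenvalue hj, hasEigenvalue_of_pow_six_eq_one h5 hj⟩,
    fun hp3 h7 => ?_⟩
  have h3 := three_ne_zero_of_five_le (p := p) (by omega)
  have hz := exp_two_pi_I_div_six_sq
  -- From `z² = z - 1` one gets `z * (1 - z) = 1`, so all four nonreal roots become polynomials in
  -- `z`.
  have hz' : Complex.exp (-(2 * Real.pi * Complex.I / 6)) =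
      1 - Complex.exp (2 * Real.pi * Complex.I / 6) := by
    rw [Complex.exp_neg]
    exact inv_eq_of_mul_eq_one_right (by linear_combination -hz)
  rw [hz']
  set z := Complex.exp (2 * Real.pi * Complex.I / 6)
  refine ⟨?_, ?_, ?_, ?_, ?_, ?_⟩
  · have h := eigenMultiplicity_concreteFourier_plane hp3 h3 hj (one_pow 6)
    have hn : 6 * eigenMultiplicity (concreteFourier j) 1 = p ^ 2 + p + 4 := by
      have : 6 * (eigenMultiplicity (concreteFourier j) 1 : ℂ) = (p : ℂ) ^ 2 + p + 4 := by
        rw [h]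
        ring
      exact_mod_cast this
    have h' : 6 * (eigenMultiplicity (concreteFourier j) 1 : ℚ) = (p : ℚ) ^ 2 + p + 4 := by
      exact_mod_cast hn
    linear_combination h' / 6
  · have h := eigenMultiplicity_concreteFourier_plane hp3 h3 hj
      (μ := -1) (by norm_num)
    have h' : (eigenMultiplicity (concreteFourier j) (-1) : ℚ) = ((p : ℚ) ^ 2 - p) / 6 := by
      have : (eigenMultiplicity (concreteFourier j) (-1) : ℂ) = ((p : ℂ) ^ 2 - p) / 6 := by
        rw [h]
        ring
      exact_mod_cast this
    rw [h']
    ring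
  · rw [eigenMultiplicity_of_sq_eq_sub_one hp3 h3 hj hz]
    ring
  · rw [eigenMultiplicity_of_sq_eq_sub_one hp3 h3 hj (by linear_combination hz)]
    ring
  · rw [eigenMultiplicity_of_sq_eq_neg_sub_one hp3 h3 hj (by linear_combination hz)]
    ring
  · rw [eigenMultiplicity_of_sq_eq_neg_sub_one hp3 h3 hj (by linear_combination hz)]
    ring
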